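/- Let $N=\{1,\dots,n\}$ be a set of agents and $O=\{o_1,\dots,o_n\}$ a set of items, and let $u_{ij}$ be the utility of agent $i$ for item $o_j$. Assume that the utilities are bi-valued: for each $i$ there are $\alpha_i>\beta_i\ge 0$ with $u_{ij}\in\{\alpha_i,\beta_i\}$ for all $j$. A balanced allocation is a vector $y\in[0,1]^n$ with $\sum_j y_j=1$; its utility for agent $i$ is $u_i(y)=\sum_j u_{ij}y_j$. A balanced assignment is a matrix $x=(x_{ij})\in[0,1]^{n\times n}$ all of whose rows $x_i$ and columns sum to $1$. It is an HZ (Hylland--Zeckhauser) solution if there is a price vector $p=(p_1,\dots,p_n)\in\mathbb R^n$ supporting it, i.e. such that, for every agent $i$, $x_i$ maximizes $u_i$ among all balanced allocations $y$ with $\sum_j p_jy_j\le 1$ (and itself satisfies this constraint), and $\sum_j p_jx_{ij}=\min\{\sum_j p_jy_j : y \text{ a balanced allocation with } u_i(y)\ge u_i(x_i)\}$. Let $D_i$ be the set of items that agent $i$ most prefers. Then: 1. (Rationality) In every HZ solution $x$ and for every agent $i$, the amount $\sum_{o_j\in D_i}x_{ij}$ of most preferred items that $i$ receives is a rational number; hence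 $u_i(x_i)$ is rational whenever all $u_{ij}$, $j=1,\dots,n$, are rational. Moreover, there is an HZ solution all of whose entries are rational and which is supported by nonnegative rational prices. 2. (Uniqueness of utilities) If $x$ and $y$ are HZ solutions, then $u_i(x_i)=u_i(y_i)$ for every agent $i$. 3. (Invariance) For all real numbers $a_i>0$ and $b_i$ ($i\in N$), the set of HZ solutions for the utilities $a_iu_{ij}+b_i$ equals the set of HZ solutions for the utilities $u_{ij}$. -/

import Mathlib

open scoped BigOperators

namespace HZ

/-- `y` is a balanced allocation (a point of `A_b`): fractions of the `n` items of total size `1`. -/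
def IsBalancedAllocation {n : ℕ} (y : Fin n → ℝ) : Prop :=
  (∀ j, y j ∈ Set.Icc (0 : ℝ) 1) ∧ ∑ j, y j = 1

/-- `x` is a fractional assignment (a point of `F`): `x i j` is the fraction of item `j` that
agent `i` receives, and every item is fully allocated. -/
def IsFractionalAssignment {n : ℕ} (x : Fin n → Fin n → ℝ) : Prop :=
  (∀ i j, x i j ∈ Set.Icc (0 : ℝ) 1) ∧ ∀ j, ∑ i, x i j = 1

/-- `x` is a balanced fractional assignment (a point of `F_b`). -/
def IsBalancedAssignment {n : ℕ} (x : Fin n → Fin n → ℝ) : Prop :=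
  IsFractionalAssignment x ∧ ∀ i, ∑ j, x i j = 1

/-- The expected utility of the allocation `y` for an agent whose utility for item `j` is `v j`. -/
def utility {n : ℕ} (v y : Fin n → ℝ) : ℝ := ∑ j, y j * v j

/-- The cost of the allocation `y` under the item prices `p`. -/
def cost {n : ℕ} (p y : Fin n → ℝ) : ℝ := ∑ j, p j * y j

/-- The balanced allocations that are affordable with budget `1` under the prices `p`. -/
def budgetSet {n : ℕ} (p : Fin n → ℝ) : Set (Fin n → ℝ) :=
  {y | IsBalancedAllocation y ∧ cost p y ≤ 1}

/-- The prices `p` support the balanced assignment `x` as an HZ solution for the utility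
profile `u`: every agent receives a utility-maximal balanced allocation within budget `1`, and a
cheapest one among the balanced allocations that are at least as good for her. -/
def Supports {n : ℕ} (u : Fin n → Fin n → ℝ) (p : Fin n → ℝ) (x : Fin n → Fin n → ℝ) : Prop :=
  ∀ i,
    (x i ∈ budgetSet p ∧ IsMaxOn (utility (u i)) (budgetSet p) (x i)) ∧
    IsLeast (cost p '' {y | IsBalancedAllocation y ∧ utility (u i) (x i) ≤ utility (u i) y})
      (cost p (x i))

/-- `x` is an HZ solution for the utility profile `u`. -/
def IsHZSolution {n : ℕ} (u : Fin n → Fin n → ℝ) (x : Fin n → Fin n → ℝ) : Prop :=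
  IsBalancedAssignment x ∧ ∃ p : Fin n → ℝ, Supports u p x

/-- Bi-valued utilities: `u i j ∈ {α i, β i}` with `α i > β i ≥ 0`. -/
def IsBiValued {n : ℕ} (u : Fin n → Fin n → ℝ) : Prop :=
  ∃ α β : Fin n → ℝ, (∀ i, 0 ≤ β i ∧ β i < α i) ∧ ∀ i j, u i j = α i ∨ u i j = β i

open Classical in
/-- The set `D_i` of items most preferred by agent `i`. -/
noncomputable def mostPreferred {n : ℕ} (u : Fin n → Fin n → ℝ) (i : Fin n) : Finset (Fin n) :=
  Finset.univ.filter fun j => ∀ k, u i k ≤ u i j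

/-- The real number `r` is rational. -/
def IsRational (r : ℝ) : Prop := ∃ q : ℚ, (q : ℝ) = r

end HZ

/-! With bi-valued utilities, an agent ranks balanced allocations by her share `d` of most preferred
items (`IsBiValued.utility_le_iff`), so everything reduces to these shares.

Uniqueness: supporting prices can be normalized to have minimum `0`. Optimality then yields the
first-order conditions for maximizing `∑ log d_i` (`Supports.exists_multiplier`). Summed over
agents, they bound `∑ d_i(y) / d_i(x)` by `n` for every balanced assignment `y`. If `y` is an HZ
solution too, the reverse bound also holds, and `a/b + b/a ≥ 2` forces equal shares.

Existence: a set `S` of agents maximizing `|S| / |N(S)|`, where `N(S)` is the set of items desired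
in `S`, is served from `N(S)` at price `|S| / |N(S)|`. Removing `S` and `N(S)` and repeating gives
nonincreasing prices, until Hall's condition holds and the remaining agents are served for free. All
data are rational, and by uniqueness the shares in every HZ solution are rational. -/

namespace HZ

/-! ### Rational equilibria of bipartite demand graphs -/

/-- A fractional Hall theorem: a bipartite graph satisfying Hall's condition with demands `c i / b`
has a rational fractional matching meeting these demands. -/
theorem exists_fractional_matching {ι κ : Type*} [Fintype ι] [DecidableEq ι] [Fintype κ]
    [DecidableEq κ] (c : ι → ℕ) (b : ℕ) (hb : 0 < b) (D : ι → Finset κ)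
    (h : ∀ T : Finset ι, ∑ i ∈ T, c i ≤ b * (T.biUnion D).card) :
    ∃ x : ι → κ → ℚ, (∀ i j, 0 ≤ x i j) ∧ (∀ i j, x i j ≠ 0 → j ∈ D i) ∧
      (∀ i, ∑ j, x i j = c i / b) ∧ ∀ j, ∑ i, x i j ≤ 1 := by
  classical
  -- Split agent `i` into `c i` copies and each item into `b` pieces of size `1 / b`; the integral
  -- Hall theorem then applies.
  let t : (Σ i, Fin (c i)) → Finset (κ × Fin b) := fun s => D s.1 ×ˢ Finset.univ
  have hall : ∀ U : Finset (Σ i, Fin (c i)), U.card ≤ (U.biUnion t).card := by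
    intro U
    have h1 : U ⊆ (U.image Sigma.fst).sigma fun _ => Finset.univ := by
      intro s hs
      simp only [Finset.mem_sigma, Finset.mem_univ, and_true]
      exact Finset.mem_image_of_mem _ hs
    have h2 : U.biUnion t = ((U.image Sigma.fst).biUnion D) ×ˢ Finset.univ := by
      ext ⟨j, k⟩
      simp [t]
    have h3 := Finset.card_le_card h1
    rw [Finset.card_sigma] at h3
    rw [h2, Finset.card_product]
    simp only [Finset.card_univ, Fintype.card_fin] at h3 ⊢
    linarith [h (U.image Sigma.fst), mul_comm b ((U.image Sigma.fst).biUnion D).card]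
  obtain ⟨f, hf, hft⟩ := (Finset.all_card_le_biUnion_card_iff_exists_injective t).1 hall
  have hb' : (0 : ℚ) < b := by exact_mod_cast hb
  let cnt : ι → κ → ℕ := fun i j => (Finset.univ.filter fun k : Fin (c i) => (f ⟨i, k⟩).1 = j).card
  refine ⟨fun i j => (cnt i j : ℚ) / b, fun i j => by positivity, ?_, ?_, ?_⟩
  · intro i j hij
    have h0 : cnt i j ≠ 0 := by
      rintro h0
      simp [h0] at hij
    obtain ⟨k, hk⟩ := Finset.card_ne_zero.1 h0
    have h1 := hft ⟨i, k⟩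
    simp only [t, Finset.mem_product, Finset.mem_univ, and_true] at h1
    rwa [(Finset.mem_filter.1 hk).2] at h1
  · intro i
    have h1 := Finset.card_eq_sum_card_fiberwise (s := (Finset.univ : Finset (Fin (c i))))
      (t := (Finset.univ : Finset κ)) (f := fun k => (f ⟨i, k⟩).1) (by simp [Set.MapsTo])
    rw [← Finset.sum_div, ← Nat.cast_sum, ← h1]
    simp
  · intro j
    rw [← Finset.sum_div, ← Nat.cast_sum, div_le_one hb', Nat.cast_le]
    have h1 : ∑ i, cnt i j =
        (Finset.univ.filter fun s : Σ i, Fin (c i) => (f s).1 = j).card := by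
      rw [← Finset.card_sigma]
      congr 1
      ext ⟨i, k⟩
      simp
    rw [h1]
    calc _ ≤ (Finset.univ : Finset (Fin b)).card := by
          refine Finset.card_le_card_of_injOn (fun s => (f s).2) (by simp [Set.MapsTo]) ?_
          intro s hs s' hs' hss
          simp only [Finset.coe_filter, Finset.mem_univ, true_and, Set.mem_ofPred_eq] at hs hs'
          exact hf (Prod.ext (hs.trans hs'.symm) hss)
      _ = b := by simp

/-- Rational equilibrium prices `p` and purchases `x` of desired items: each agent `i ∈ A` buys at
her lowest price `m i` and gets the share `min 1 (1 / m i)`, and items of positive price are sold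
out. -/
theorem exists_rational_equilibrium {ι κ : Type*} [Fintype ι] [DecidableEq ι] [Fintype κ]
    [DecidableEq κ] (A : Finset ι) (D : ι → Finset κ) (R : ℚ) (hR : 0 ≤ R)
    (h : ∀ T ⊆ A, (T.card : ℚ) ≤ R * (T.biUnion D).card) :
    ∃ (x : ι → κ → ℚ) (p : κ → ℚ) (m : ι → ℚ), (∀ i j, 0 ≤ x i j) ∧
      (∀ i j, x i j ≠ 0 → i ∈ A ∧ j ∈ D i ∧ p j = m i) ∧ (∀ j, 0 ≤ p j ∧ p j ≤ R) ∧
      (∀ i ∈ A, 0 ≤ m i ∧ m i ≤ R ∧ (∀ k ∈ D i, m i ≤ p k) ∧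
        ((∑ j, x i j = 1 ∧ m i ≤ 1) ∨ (∑ j, x i j ≤ 1 ∧ m i * ∑ j, x i j = 1))) ∧
      ∀ j, ∑ i, x i j ≤ 1 ∧ (p j = 0 ∨ ∑ i, x i j = 1) := by
  induction hA : A.card using Nat.strong_induction_on generalizing A D R with
  | _ N ih =>
  by_cases hall : ∀ T ⊆ A, T.card ≤ (T.biUnion D).card
  · obtain ⟨x, hx0, hxD, hxr, hxc⟩ := exists_fractional_matching
      (fun i => if i ∈ A then 1 else 0) 1 one_pos D (by
        intro T
        rw [← Finset.sum_filter, Finset.sum_const, smul_eq_mul, mul_one, one_mul]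
        refine (hall (T.filter (· ∈ A)) fun i hi => (Finset.mem_filter.1 hi).2).trans ?_
        exact Finset.card_le_card (Finset.biUnion_subset_biUnion_of_subset_left _
          (Finset.filter_subset _ _)))
    refine ⟨x, fun _ => 0, fun _ => 0, hx0, fun i j hij => ⟨?_, hxD i j hij, rfl⟩,
      fun _ => ⟨le_rfl, hR⟩, fun i hi => ⟨le_rfl, hR, fun _ _ => le_rfl, Or.inl ⟨?_, zero_le_one⟩⟩,
      fun j => ⟨hxc j, Or.inl rfl⟩⟩
    · by_contra hi
      have := hxr i
      simp only [hi, if_false, Nat.cast_zero, zero_div] at this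
      rw [Finset.sum_eq_zero_iff_of_nonneg fun j _ => hx0 i j] at this
      exact hij (this j (Finset.mem_univ j))
    · simp [hxr i, hi]
  · push Not at hall
    obtain ⟨T₀, hT₀A, hT₀⟩ := hall
    have hT₀n : T₀.Nonempty := Finset.card_pos.1 (by omega)
    -- `S` is a most overdemanded set; its ratio `P` becomes the price of all items desired in `S`.
    obtain ⟨S, hS, hmax⟩ := Finset.exists_max_image (A.powerset.filter Finset.Nonempty)
      (fun T => (T.card : ℚ) / (T.biUnion D).card)
      ⟨T₀, by simp [hT₀A, hT₀n]⟩
    simp only [Finset.mem_filter, Finset.mem_powerset] at hS hmax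
    obtain ⟨hSA, hSn⟩ := hS
    have hpos : ∀ T ⊆ A, T.Nonempty → (0 : ℚ) < (T.biUnion D).card := by
      intro T hT hTn
      have h1 := h T hT
      have h2 : (0 : ℚ) < T.card := by exact_mod_cast Finset.card_pos.2 hTn
      rcases Nat.eq_zero_or_pos (T.biUnion D).card with h3 | h3
      · rw [h3, Nat.cast_zero, mul_zero] at h1
        linarith
      · exact_mod_cast h3
    have hb : (0 : ℚ) < S.card := by exact_mod_cast Finset.card_pos.2 hSn
    have ha := hpos S hSA hSn
    obtain ⟨P, hP⟩ : ∃ P : ℚ, P = (S.card : ℚ) / (S.biUnion D).card := ⟨_, rfl⟩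
    have hPS : P * (S.biUnion D).card = S.card := by rw [hP]; field_simp
    have hPT : ∀ T ⊆ A, (T.card : ℚ) ≤ P * (T.biUnion D).card := by
      intro T hT
      rcases T.eq_empty_or_nonempty with rfl | hTn
      · simp
      · have := hmax T ⟨hT, hTn⟩
        rwa [div_le_iff₀ (hpos T hT hTn), ← hP] at this
    have hP0 : 0 < P := by rw [hP]; positivity
    -- Hall's condition fails at `T₀`, so `P > 1`, and the shares `1 / P` are less than one unit.
    have hP1 : 1 < P := by
      have h1 := hPT T₀ hT₀A
      have h2 : ((T₀.biUnion D).card : ℚ) < T₀.card := by exact_mod_cast hT₀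
      by_contra h3
      nlinarith [hpos T₀ hT₀A hT₀n]
    have hPR : P ≤ R := by
      rw [hP, div_le_iff₀ ha]
      exact h S hSA
    obtain ⟨y, hy0, hyD, hyr, hyc⟩ := exists_fractional_matching
      (fun i => if i ∈ S then (S.biUnion D).card else 0) S.card (Finset.card_pos.2 hSn) D (by
        intro T
        rw [← Finset.sum_filter, Finset.sum_const, smul_eq_mul]
        have h1 := hPT (T.filter (· ∈ S)) fun i hi => hSA (Finset.mem_filter.1 hi).2
        rw [hP, div_mul_eq_mul_div, le_div_iff₀ ha] at h1
        norm_cast at h1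
        refine h1.trans (Nat.mul_le_mul_left _ ?_)
        exact Finset.card_le_card (Finset.biUnion_subset_biUnion_of_subset_left _
          (Finset.filter_subset _ _)))
    have hyS : ∀ i j, y i j ≠ 0 → i ∈ S := by
      intro i j hij
      by_contra hi
      have := hyr i
      simp only [hi, if_false, Nat.cast_zero, zero_div] at this
      rw [Finset.sum_eq_zero_iff_of_nonneg fun j _ => hy0 i j] at this
      exact hij (this j (Finset.mem_univ j))
    have hyrS : ∀ i ∈ S, P * ∑ j, y i j = 1 := by
      intro i hi
      rw [hyr, hP, if_pos hi]
      field_simp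
    have hyN : ∀ i j, y i j ≠ 0 → j ∈ S.biUnion D := fun i j hij =>
      Finset.mem_biUnion.2 ⟨i, hyS i j hij, hyD i j hij⟩
    -- The shares `1 / P` of the agents in `S` add up to the number of items they desire, so no
    -- column can be slack.
    have hycN : ∀ j ∈ S.biUnion D, ∑ i, y i j = 1 := by
      have h1 : ∑ j ∈ S.biUnion D, ∑ i, y i j = ∑ j ∈ S.biUnion D, 1 := by
        calc ∑ j ∈ S.biUnion D, ∑ i, y i j = ∑ j, ∑ i, y i j := by
              refine Finset.sum_subset (Finset.subset_univ _) fun j _ hj => ?_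
              refine Finset.sum_eq_zero fun i _ => ?_
              by_contra hij
              exact hj (hyN i j hij)
          _ = ∑ i, ∑ j, y i j := Finset.sum_comm
          _ = ∑ i ∈ S, ((S.biUnion D).card : ℚ) / S.card := by
              rw [← Finset.sum_filter_add_sum_filter_not Finset.univ (· ∈ S)]
              simp only [hyr]
              rw [Finset.sum_eq_zero (s := Finset.univ.filter (· ∉ S)), add_zero]
              · rw [Finset.filter_mem_eq_inter, Finset.univ_inter]
                exact Finset.sum_congr rfl fun i hi => by simp [hi]
              · intro i hi
                simp [(Finset.mem_filter.1 hi).2]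
          _ = _ := by
              simp only [Finset.sum_const, nsmul_eq_mul, mul_one]
              field_simp
      exact (Finset.sum_eq_sum_iff_of_le fun j _ => hyc j).1 h1
    -- Recursion with price bound `P`: subtracting `|S| = P |N(S)|` from the bound for `T ∪ S` gives
    -- the required bound for `T`. Later prices are at most `P`, so the removed items never undercut
    -- what a remaining agent pays.
    obtain ⟨z, q, m, hz0, hzs, hq, hm, hzc⟩ := ih (A \ S).card (by
        rw [← hA]
        exact Finset.card_lt_card (Finset.sdiff_ssubset hSA hSn))
      (A \ S) (fun i => D i \ S.biUnion D) P hP0.le (by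
        intro T hT
        have hTS : Disjoint T S := Finset.disjoint_of_subset_left hT Finset.sdiff_disjoint
        have h1 := hPT (T ∪ S)
          (Finset.union_subset (hT.trans Finset.sdiff_subset) hSA)
        have h2 : (T ∪ S).biUnion D =
            (T.biUnion fun i => D i \ S.biUnion D) ∪ S.biUnion D := by
          ext j
          simp only [Finset.mem_biUnion, Finset.mem_union, Finset.mem_sdiff]
          grind
        have h3 : Disjoint (T.biUnion fun i => D i \ S.biUnion D) (S.biUnion D) := by
          rw [Finset.disjoint_biUnion_left]
          exact fun i _ => Finset.sdiff_disjoint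
        rw [h2, Finset.card_union_of_disjoint hTS, Finset.card_union_of_disjoint h3] at h1
        push_cast at h1
        linarith) rfl
    have hzS : ∀ i ∈ S, ∀ j, z i j = 0 := by
      intro i hi j
      by_contra hij
      exact (Finset.mem_sdiff.1 (hzs i j hij).1).2 hi
    have hzN : ∀ j ∈ S.biUnion D, ∀ i, z i j = 0 := by
      intro j hj i
      by_contra hij
      exact (Finset.mem_sdiff.1 (hzs i j hij).2.1).2 hj
    have hyS' : ∀ i ∉ S, ∀ j, y i j = 0 := fun i hi j => by
      by_contra hij
      exact hi (hyS i j hij)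
    have hyN' : ∀ j ∉ S.biUnion D, ∀ i, y i j = 0 := fun j hj i => by
      by_contra hij
      exact hj (hyN i j hij)
    refine ⟨fun i j => y i j + z i j, fun j => if j ∈ S.biUnion D then P else q j,
      fun i => if i ∈ S then P else m i, fun i j => add_nonneg (hy0 i j) (hz0 i j), ?_, ?_, ?_, ?_⟩
    · intro i j hij
      dsimp only at hij ⊢
      by_cases hi : i ∈ S
      · rw [hzS i hi j, add_zero] at hij
        exact ⟨hSA hi, hyD i j hij, by rw [if_pos (hyN i j hij), if_pos hi]⟩
      · rw [hyS' i hi j, zero_add] at hij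
        obtain ⟨h1, h2, h3⟩ := hzs i j hij
        rw [Finset.mem_sdiff] at h1 h2
        exact ⟨h1.1, h2.1, by rw [if_neg h2.2, if_neg hi, h3]⟩
    · intro j
      dsimp only
      split_ifs
      · exact ⟨hP0.le, hPR⟩
      · exact ⟨(hq j).1, (hq j).2.trans hPR⟩
    · intro i hi
      by_cases hiS : i ∈ S
      · simp only [hiS, if_true, hzS i hiS, add_zero]
        refine ⟨hP0.le, hPR, fun k hk => ?_, Or.inr ⟨?_, hyrS i hiS⟩⟩
        · rw [if_pos (Finset.mem_biUnion.2 ⟨i, hiS, hk⟩)]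
        · have h1 := hyrS i hiS
          have h2 : 0 ≤ ∑ j, y i j := Finset.sum_nonneg fun j _ => hy0 i j
          nlinarith
      · simp only [hiS, if_false, hyS' i hiS, zero_add]
        obtain ⟨h1, h2, h3, h4⟩ := hm i (Finset.mem_sdiff.2 ⟨hi, hiS⟩)
        refine ⟨h1, h2.trans hPR, fun k hk => ?_, h4⟩
        split_ifs with hkS
        · exact h2
        · exact h3 k (Finset.mem_sdiff.2 ⟨hk, hkS⟩)
    · intro j
      by_cases hj : j ∈ S.biUnion D
      · simp only [hj, if_true, hzN j hj, add_zero, hycN j hj]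
        exact ⟨le_rfl, Or.inr trivial⟩
      · simp only [hj, if_false, hyN' j hj, zero_add]
        exact hzc j


/-- A nonnegative square matrix with row and column sums at most `1` can be enlarged to a doubly
stochastic one without touching its saturated rows and columns. -/
theorem exists_doublyStochastic_extension {n : ℕ} (x : Fin n → Fin n → ℚ)
    (hr : ∀ i, ∑ j, x i j ≤ 1) (hc : ∀ j, ∑ i, x i j ≤ 1) :
    ∃ e : Fin n → Fin n → ℚ, (∀ i j, 0 ≤ e i j) ∧ (∀ i, ∑ j, (x i j + e i j) = 1) ∧
      (∀ j, ∑ i, (x i j + e i j) = 1) ∧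
      ∀ i j, e i j ≠ 0 → ∑ k, x i k ≠ 1 ∧ ∑ k, x k j ≠ 1 := by
  obtain ⟨r, hr'⟩ : ∃ r : Fin n → ℚ, ∀ i, r i = 1 - ∑ j, x i j := ⟨_, fun _ => rfl⟩
  obtain ⟨s, hs'⟩ : ∃ s : Fin n → ℚ, ∀ j, s j = 1 - ∑ i, x i j := ⟨_, fun _ => rfl⟩
  have hr0 : ∀ i, 0 ≤ r i := fun i => by linarith [hr i, hr' i]
  have hs0 : ∀ j, 0 ≤ s j := fun j => by linarith [hc j, hs' j]
  have hrs : ∑ i, r i = ∑ j, s j := by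
    simp only [hr', hs', Finset.sum_sub_distrib]
    rw [Finset.sum_comm]
  have hdiv : ∀ t : Fin n → ℚ, (∀ i, 0 ≤ t i) → ∀ i, t i * (∑ k, t k) / ∑ k, t k = t i := by
    intro t ht i
    by_cases h0 : ∑ k, t k = 0
    · rw [h0, div_zero, (Finset.sum_eq_zero_iff_of_nonneg fun k _ => ht k).1 h0 i
        (Finset.mem_univ i)]
    · field_simp
  -- Spread the row deficits `r` over the column deficits `s` proportionally. If the total deficit
  -- is `0`, the quotient is `0`, as it should be.
  refine ⟨fun i j => r i * s j / ∑ k, s k, fun i j => ?_, fun i => ?_, fun j => ?_,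
    fun i j hij => ⟨fun h => hij ?_, fun h => hij ?_⟩⟩
  · exact div_nonneg (mul_nonneg (hr0 i) (hs0 j)) (Finset.sum_nonneg fun k _ => hs0 k)
  · rw [Finset.sum_add_distrib, ← Finset.sum_div, ← Finset.mul_sum, ← hrs, hdiv r hr0, hr']
    ring
  · rw [Finset.sum_add_distrib, ← Finset.sum_div, ← Finset.sum_mul, hrs, mul_comm, hdiv s hs0, hs']
    ring
  · simp [hr', h]
  · simp [hs', h]

/-- Every profile of nonempty demand sets admits a rational doubly stochastic assignment and
nonnegative rational prices at which each agent `i` spends `m i` per unit of desired items, where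
`m i` is at most the price of any desired item, and nothing on the rest. -/
theorem exists_rational_assignment {n : ℕ} (D : Fin n → Finset (Fin n))
    (hD : ∀ i, (D i).Nonempty) :
    ∃ (x : Fin n → Fin n → ℚ) (p m : Fin n → ℚ), (∀ i j, 0 ≤ x i j) ∧ (∀ i, ∑ j, x i j = 1) ∧
      (∀ j, ∑ i, x i j = 1) ∧ (∀ j, 0 ≤ p j) ∧ ∀ i, 0 ≤ m i ∧ (∀ k ∈ D i, m i ≤ p k) ∧
        ∑ j, p j * x i j = m i * ∑ j ∈ D i, x i j ∧
        ((∑ j ∈ D i, x i j = 1 ∧ m i ≤ 1) ∨ m i * ∑ j ∈ D i, x i j = 1) := by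
  obtain ⟨x, p, m, hx0, hxs, hp, hm, hc⟩ := exists_rational_equilibrium Finset.univ D n
    (Nat.cast_nonneg n) (by
      intro T _
      rcases T.eq_empty_or_nonempty with rfl | ⟨i, hi⟩
      · simp
      · have h1 : T.card ≤ n := by simpa using Finset.card_le_univ T
        have h2 : 1 ≤ (T.biUnion D).card := by
          obtain ⟨j, hj⟩ := hD i
          exact Finset.card_pos.2 ⟨j, Finset.mem_biUnion.2 ⟨i, hi, hj⟩⟩
        exact_mod_cast h1.trans (Nat.le_mul_of_pos_right n h2))
  have hr : ∀ i, ∑ j, x i j ≤ 1 := fun i =>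
    (hm i (Finset.mem_univ i)).2.2.2.elim (fun h => h.1.le) fun h => h.1
  obtain ⟨e, he0, her, hec, hes⟩ := exists_doublyStochastic_extension x hr fun j => (hc j).1
  -- Only items that are not sold out get filled in, and these are free.
  have hep : ∀ i j, p j * e i j = 0 := by
    intro i j
    by_cases h : e i j = 0
    · rw [h, mul_zero]
    · rw [(hc j).2.resolve_right (hes i j h).2, zero_mul]
  -- An agent with an unfilled row has `m i > 0`, so all her desired items have positive price and
  -- are sold out.
  have heD : ∀ i, ∀ j ∈ D i, e i j = 0 := by
    intro i j hj
    by_contra h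
    obtain ⟨h0, -, h1, h2⟩ := hm i (Finset.mem_univ i)
    have h3 := h1 j hj
    rw [(hc j).2.resolve_right (hes i j h).2] at h3
    have h4 := (h2.resolve_left fun h5 => (hes i j h).1 h5.1).2
    rw [le_antisymm h3 h0, zero_mul] at h4
    exact zero_ne_one h4
  have hsum : ∀ i, ∑ j ∈ D i, (x i j + e i j) = ∑ j, x i j := by
    intro i
    rw [Finset.sum_congr rfl fun j hj => by rw [heD i j hj, add_zero]]
    refine Finset.sum_subset (Finset.subset_univ _) fun j _ hj => ?_
    by_contra h
    exact hj (hxs i j h).2.1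
  refine ⟨fun i j => x i j + e i j, p, m, fun i j => add_nonneg (hx0 i j) (he0 i j), her, hec,
    fun j => (hp j).1, fun i => ?_⟩
  obtain ⟨h0, -, h1, h2⟩ := hm i (Finset.mem_univ i)
  rw [hsum i]
  refine ⟨h0, h1, ?_, h2.imp id fun h => h.2⟩
  rw [Finset.mul_sum]
  refine Finset.sum_congr rfl fun j _ => ?_
  rw [mul_add, hep, add_zero]
  by_cases h : x i j = 0
  · rw [h, mul_zero, mul_zero]
  · rw [(hxs i j h).2.2]

/-! ### Bi-valued utilities -/

theorem mostPreferred_nonempty {n : ℕ} (u : Fin n → Fin n → ℝ) (i : Fin n) :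
    (mostPreferred u i).Nonempty := by
  obtain ⟨j, -, hj⟩ := Finset.exists_max_image Finset.univ (u i) ⟨i, Finset.mem_univ i⟩
  exact ⟨j, by simpa [mostPreferred] using hj⟩

theorem IsBiValued.exists_two_levels {n : ℕ} {u : Fin n → Fin n → ℝ} (hu : IsBiValued u)
    (i : Fin n) :
    ∃ M m : ℝ, m < M ∧ (∀ j ∈ mostPreferred u i, u i j = M) ∧
      ∀ j ∉ mostPreferred u i, u i j = m := by
  obtain ⟨α, β, hαβ, h⟩ := hu
  by_cases hα : ∃ k, u i k = α i
  · obtain ⟨k, hk⟩ := hα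
    refine ⟨α i, β i, (hαβ i).2, fun j hj => ?_, fun j hj => ?_⟩
    · have h1 : u i k ≤ u i j := (Finset.mem_filter.1 hj).2 k
      rcases h i j with h2 | h2
      · exact h2
      · linarith [(hαβ i).2]
    · refine (h i j).resolve_left fun h2 => hj ?_
      refine Finset.mem_filter.2 ⟨Finset.mem_univ j, fun l => ?_⟩
      rcases h i l with h3 | h3 <;> linarith [(hαβ i).2]
  · push Not at hα
    have h1 : ∀ j, u i j = β i := fun j => (h i j).resolve_left (hα j)
    -- All items are most preferred here, so the lower level is never attained and any smaller
    -- number will do.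
    refine ⟨β i, β i - 1, by linarith, fun j _ => h1 j, fun j hj => (hj ?_).elim⟩
    exact Finset.mem_filter.2 ⟨Finset.mem_univ j, fun l => by rw [h1, h1]⟩

theorem utility_eq_of_two_levels {n : ℕ} {v y : Fin n → ℝ} {D : Finset (Fin n)} {M m : ℝ}
    (hM : ∀ j ∈ D, v j = M) (hm : ∀ j ∉ D, v j = m) (hy : IsBalancedAllocation y) :
    utility v y = M * ∑ j ∈ D, y j + m * (1 - ∑ j ∈ D, y j) := by
  have h1 : 1 - ∑ j ∈ D, y j = ∑ j ∈ Dᶜ, y j := by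
    rw [← hy.2, ← Finset.sum_add_sum_compl D]
    ring
  rw [h1, utility, ← Finset.sum_add_sum_compl D, Finset.mul_sum, Finset.mul_sum]
  congr 1 <;> refine Finset.sum_congr rfl fun j hj => ?_
  · rw [hM j hj, mul_comm]
  · rw [hm j (Finset.mem_compl.1 hj), mul_comm]

/-- Total weight `1` makes the utility an increasing affine function of the share of most preferred
items. -/
theorem IsBiValued.utility_le_iff {n : ℕ} {u : Fin n → Fin n → ℝ} (hu : IsBiValued u) (i : Fin n)
    {y z : Fin n → ℝ} (hy : IsBalancedAllocation y) (hz : IsBalancedAllocation z) :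
    utility (u i) y ≤ utility (u i) z ↔
      ∑ j ∈ mostPreferred u i, y j ≤ ∑ j ∈ mostPreferred u i, z j := by
  obtain ⟨M, m, hmM, h1, h2⟩ := hu.exists_two_levels i
  rw [utility_eq_of_two_levels h1 h2 hy, utility_eq_of_two_levels h1 h2 hz]
  constructor <;> intro h <;> nlinarith

theorem sum_le_one_of_isBalancedAllocation {n : ℕ} {y : Fin n → ℝ} (hy : IsBalancedAllocation y)
    (D : Finset (Fin n)) : ∑ j ∈ D, y j ≤ 1 := by
  rw [← hy.2]
  exact Finset.sum_le_univ_sum_of_nonneg fun j => (hy.1 j).1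

theorem isBalancedAllocation_of_nonneg {n : ℕ} {y : Fin n → ℝ} (h0 : ∀ j, 0 ≤ y j)
    (h1 : ∑ j, y j = 1) : IsBalancedAllocation y := by
  refine ⟨fun j => ⟨h0 j, ?_⟩, h1⟩
  rw [← h1]
  exact Finset.single_le_sum (fun k _ => h0 k) (Finset.mem_univ j)

theorem IsBalancedAssignment.row {n : ℕ} {x : Fin n → Fin n → ℝ} (hx : IsBalancedAssignment x)
    (i : Fin n) : IsBalancedAllocation (x i) :=
  ⟨hx.1.1 i, hx.2 i⟩

/-- The convex combination of two unit allocations. -/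
theorem isBalancedAllocation_mix {n : ℕ} (k l : Fin n) {t : ℝ} (h0 : 0 ≤ t) (h1 : t ≤ 1) :
    IsBalancedAllocation (fun j => t * (if j = k then 1 else 0) + (1 - t) * if j = l then 1 else 0)
    := by
  refine isBalancedAllocation_of_nonneg (fun j => ?_) ?_
  · have : 0 ≤ 1 - t := by linarith
    positivity
  · simp [Finset.sum_add_distrib]

theorem cost_mix {n : ℕ} (p : Fin n → ℝ) (k l : Fin n) (t : ℝ) :
    cost p (fun j => t * (if j = k then 1 else 0) + (1 - t) * if j = l then 1 else 0) =
      t * p k + (1 - t) * p l := by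
  simp [cost, mul_add, Finset.sum_add_distrib, mul_comm]

/-- Every item is sold completely, so total spending does not depend on the assignment. -/
theorem IsBalancedAssignment.sum_cost {n : ℕ} {x : Fin n → Fin n → ℝ}
    (hx : IsBalancedAssignment x) (p : Fin n → ℝ) : ∑ i, cost p (x i) = ∑ j, p j := by
  simp only [cost]
  rw [Finset.sum_comm]
  refine Finset.sum_congr rfl fun j _ => ?_
  rw [← Finset.mul_sum, hx.1.2 j, mul_one]

/-! ### Price supports -/

/-- Supporting prices depend only on the preferences over balanced allocations, on the budget set,
and on the order of costs. -/
theorem Supports.of_order {n : ℕ} {u u' : Fin n → Fin n → ℝ} {p p' : Fin n → ℝ}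
    {x : Fin n → Fin n → ℝ} (hx : IsBalancedAssignment x)
    (hu : ∀ i y z, IsBalancedAllocation y → IsBalancedAllocation z →
      (utility (u i) y ≤ utility (u i) z ↔ utility (u' i) y ≤ utility (u' i) z))
    (hb : ∀ y, IsBalancedAllocation y → (cost p y ≤ 1 ↔ cost p' y ≤ 1))
    (hc : ∀ y z, IsBalancedAllocation y → IsBalancedAllocation z →
      cost p y ≤ cost p z → cost p' y ≤ cost p' z)
    (h : Supports u p x) : Supports u' p' x := by
  intro i
  obtain ⟨⟨h1, h2⟩, h3⟩ := h i
  have hxi := hx.row i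
  refine ⟨⟨⟨hxi, (hb _ hxi).1 h1.2⟩, isMaxOn_iff.2 fun y hy => ?_⟩,
    ⟨x i, ⟨hxi, le_rfl⟩, rfl⟩, ?_⟩
  · exact (hu i y (x i) hy.1 hxi).1 (isMaxOn_iff.1 h2 y ⟨hy.1, (hb y hy.1).2 hy.2⟩)
  · rintro _ ⟨y, ⟨hy, hyu⟩, rfl⟩
    exact hc _ _ hxi hy (h3.2 ⟨y, ⟨hy, (hu i (x i) y hxi hy).2 hyu⟩, rfl⟩)

/-- Rescaling prices about the budget level `1` fixes that level; for `c > 0` it preserves the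
budget set and the order of costs. -/
theorem cost_rescale {n : ℕ} (p : Fin n → ℝ) (c : ℝ) {y : Fin n → ℝ}
    (hy : IsBalancedAllocation y) :
    cost (fun j => 1 + c * (p j - 1)) y = 1 + c * (cost p y - 1) := by
  have h : ∀ j, (1 + c * (p j - 1)) * y j = (1 - c) * y j + c * (p j * y j) := fun j => by ring
  simp only [cost, h, Finset.sum_add_distrib, ← Finset.mul_sum, hy.2]
  ring

/-- Supporting prices can be normalized to be nonnegative with minimum `0`. -/
theorem Supports.exists_normalized {n : ℕ} (i₀ : Fin n) {u : Fin n → Fin n → ℝ} {p : Fin n → ℝ}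
    {x : Fin n → Fin n → ℝ} (hx : IsBalancedAssignment x) (h : Supports u p x) :
    ∃ p', Supports u p' x ∧ (∀ j, 0 ≤ p' j) ∧ ∃ l, p' l = 0 := by
  obtain ⟨l, -, hl⟩ := Finset.exists_min_image Finset.univ p ⟨i₀, Finset.mem_univ i₀⟩
  have hl' : ∀ j, p l ≤ p j := fun j => hl j (Finset.mem_univ j)
  by_cases hpl : p l < 1
  · have h1 : 0 < 1 - p l := by linarith
    have hc : 0 < 1 / (1 - p l) := by positivity
    refine ⟨fun j => 1 + 1 / (1 - p l) * (p j - 1), ?_, fun j => ?_, l, ?_⟩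
    · refine h.of_order hx (fun _ _ _ _ _ => Iff.rfl) (fun y hy => ?_) fun y z hy hz hyz => ?_
      · rw [cost_rescale p _ hy]
        constructor <;> intro h2 <;> nlinarith
      · rw [cost_rescale p _ hy, cost_rescale p _ hz]
        nlinarith
    · have h2 : 1 + 1 / (1 - p l) * (p j - 1) = (p j - p l) / (1 - p l) := by
        field_simp
        ring
      dsimp only
      rw [h2]
      exact div_nonneg (by linarith [hl' j]) h1.le
    · field_simp
      ring
  -- If no price is below `1`, total spending of at most `n` forces all prices to be `1`; zero
  -- prices then support `x` as well.
  · have h1 : ∀ j, 1 ≤ p j := fun j => (not_lt.1 hpl).trans (hl' j)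
    have h2 : ∑ j : Fin n, (1 : ℝ) = ∑ j, p j := by
      refine le_antisymm (Finset.sum_le_sum fun j _ => h1 j) ?_
      rw [← hx.sum_cost p]
      exact Finset.sum_le_sum fun i _ => (h i).1.1.2
    have h3 : ∀ j, p j = 1 := fun j =>
      ((Finset.sum_eq_sum_iff_of_le fun j _ => h1 j).1 h2 j (Finset.mem_univ j)).symm
    refine ⟨fun _ => 0, ?_, fun _ => le_rfl, l, rfl⟩
    refine h.of_order hx (fun _ _ _ _ _ => Iff.rfl) (fun y hy => ?_) fun y z hy hz _ => ?_
    · simp [cost, h3, hy.2]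
    · simp [cost]

/-- At normalized supporting prices `p`, an agent's share `d` of most preferred items satisfies the
optimality conditions of `max log d` with some multiplier `q` of her unit demand constraint. -/
theorem Supports.exists_multiplier {n : ℕ} {u : Fin n → Fin n → ℝ} (hu : IsBiValued u)
    {p : Fin n → ℝ} {x : Fin n → Fin n → ℝ} (h : Supports u p x)
    (hp : ∀ j, 0 ≤ p j) {l : Fin n} (hl : p l = 0) (i : Fin n) :
    ∃ q : ℝ, 0 ≤ q ∧ 0 < ∑ j ∈ mostPreferred u i, x i j ∧
      (∀ j ∈ mostPreferred u i, 1 ≤ (∑ j ∈ mostPreferred u i, x i j) * (p j + q)) ∧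
      cost p (x i) + q ≤ 1 := by
  obtain ⟨⟨⟨hxi, hxb⟩, hmax⟩, hmin⟩ := h i
  obtain ⟨k, hkD, hk⟩ := Finset.exists_min_image _ p (mostPreferred_nonempty u i)
  have hpk := hp k
  -- Compare with `t` units of the cheapest desired item `k`, topped up by the free item `l`.
  have key : ∀ t : ℝ, 0 ≤ t → t ≤ 1 → t * p k ≤ 1 →
      t ≤ ∑ j ∈ mostPreferred u i, x i j := by
    intro t h0 h1 h2
    have hb := isBalancedAllocation_mix k l h0 h1
    have h3 := (hu.utility_le_iff i hb hxi).1 (isMaxOn_iff.1 hmax _ ⟨hb, by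
      rw [cost_mix, hl]; linarith⟩)
    refine le_trans ?_ h3
    rw [Finset.sum_add_distrib, ← Finset.mul_sum, Finset.sum_ite_eq', if_pos hkD, mul_one]
    have h4 : 0 ≤ 1 - t := by linarith
    exact le_add_of_nonneg_right (Finset.sum_nonneg fun j _ => by positivity)
  -- If `k` is affordable, the share is `1` and cost minimality bounds spending by `p k`, so `q = 1
  -- - p k`. Otherwise the share is at least `1 / p k` and `q = 0`.
  rcases le_or_gt (p k) 1 with hk1 | hk1
  · have hd := key 1 zero_le_one le_rfl (by linarith)
    have hb := isBalancedAllocation_mix k l zero_le_one (le_refl (1 : ℝ))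
    have hc : cost p (x i) ≤ p k := by
      have h2 : ∑ j ∈ mostPreferred u i, x i j ≤ 1 := sum_le_one_of_isBalancedAllocation hxi _
      have h3 := hmin.2 ⟨_, ⟨hb, (hu.utility_le_iff i hxi hb).2 (h2.trans ?_)⟩, rfl⟩
      · rwa [cost_mix, sub_self, zero_mul, add_zero, one_mul] at h3
      · simp [hkD]
    refine ⟨1 - p k, by linarith, by linarith, fun j hj => ?_, by linarith⟩
    nlinarith [hk j hj]
  · have hk0 : 0 < p k := by linarith
    have hd := key (1 / p k) (by positivity) ((div_le_one hk0).2 hk1.le)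
      (by rw [one_div_mul_cancel hk0.ne'])
    have hd0 : 0 < 1 / p k := by positivity
    refine ⟨0, le_rfl, hd0.trans_le hd, fun j hj => ?_, by linarith⟩
    rw [div_le_iff₀ hk0] at hd
    nlinarith [hk j hj]

/-! ### Uniqueness of shares and utilities -/

/-- In terms of most preferred shares, any balanced assignment `y` has average ratio at most `1`
to an HZ solution `x`. -/
theorem IsHZSolution.sum_share_div_le {n : ℕ} {u : Fin n → Fin n → ℝ} (hu : IsBiValued u)
    {x y : Fin n → Fin n → ℝ} (hx : IsHZSolution u x) (hy : IsBalancedAssignment y) :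
    (∀ i, 0 < ∑ j ∈ mostPreferred u i, x i j) ∧
    ∑ i, (∑ j ∈ mostPreferred u i, y i j) / (∑ j ∈ mostPreferred u i, x i j) ≤ n := by
  rcases isEmpty_or_nonempty (Fin n) with he | ⟨⟨i₀⟩⟩
  · exact ⟨fun i => he.elim i, by simp⟩
  obtain ⟨hx, p₀, hp₀⟩ := hx
  obtain ⟨p, hs, hp, l, hl⟩ := hp₀.exists_normalized i₀ hx
  choose q hq0 hd hDq hcq using hs.exists_multiplier hu hp hl
  refine ⟨hd, ?_⟩
  have h1 : ∀ i, (∑ j ∈ mostPreferred u i, y i j) / (∑ j ∈ mostPreferred u i, x i j) ≤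
      cost p (y i) + q i := by
    intro i
    rw [div_le_iff₀ (hd i)]
    have hyi := hy.row i
    have h2 := sum_le_one_of_isBalancedAllocation hyi (mostPreferred u i)
    have h3 : ∑ j ∈ mostPreferred u i, p j * y i j ≤ cost p (y i) :=
      Finset.sum_le_univ_sum_of_nonneg fun j => mul_nonneg (hp j) (hyi.1 j).1
    calc ∑ j ∈ mostPreferred u i, y i j
        ≤ ∑ j ∈ mostPreferred u i,
            ((∑ j ∈ mostPreferred u i, x i j) * (p j + q i)) * y i j :=
          Finset.sum_le_sum fun j hj => le_mul_of_one_le_left (hyi.1 j).1 (hDq i j hj)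
      _ = (∑ j ∈ mostPreferred u i, p j * y i j + q i * ∑ j ∈ mostPreferred u i, y i j) *
            ∑ j ∈ mostPreferred u i, x i j := by
          generalize ∑ j ∈ mostPreferred u i, x i j = d
          rw [Finset.mul_sum, ← Finset.sum_add_distrib, mul_comm, Finset.mul_sum]
          exact Finset.sum_congr rfl fun j _ => by ring
      _ ≤ _ := by
          refine mul_le_mul_of_nonneg_right (add_le_add h3 ?_) (hd i).le
          exact mul_le_of_le_one_right (hq0 i) h2
  calc _ ≤ ∑ i, (cost p (y i) + q i) := Finset.sum_le_sum fun i _ => h1 i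
    _ = ∑ i, (cost p (x i) + q i) := by
        rw [Finset.sum_add_distrib, Finset.sum_add_distrib, hx.sum_cost, hy.sum_cost]
    _ ≤ ∑ i : Fin n, (1 : ℝ) := Finset.sum_le_sum fun i _ => hcq i
    _ = n := by simp

/-- All HZ solutions give each agent the same amount of most preferred items. -/
theorem IsHZSolution.share_unique {n : ℕ} {u : Fin n → Fin n → ℝ} (hu : IsBiValued u)
    {x y : Fin n → Fin n → ℝ} (hx : IsHZSolution u x) (hy : IsHZSolution u y) (i : Fin n) :
    ∑ j ∈ mostPreferred u i, x i j = ∑ j ∈ mostPreferred u i, y i j := by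
  obtain ⟨hx0, hxy⟩ := hx.sum_share_div_le hu hy.1
  obtain ⟨hy0, hyx⟩ := hy.sum_share_div_le hu hx.1
  set a : Fin n → ℝ := fun i => ∑ j ∈ mostPreferred u i, x i j
  set b : Fin n → ℝ := fun i => ∑ j ∈ mostPreferred u i, y i j
  have hx0 : ∀ i, 0 < a i := hx0
  have hy0 : ∀ i, 0 < b i := hy0
  have key : ∀ i, b i / a i + a i / b i - 2 = (a i - b i) ^ 2 / (a i * b i) := fun i => by
    have := (hx0 i).ne'
    have := (hy0 i).ne'
    field_simp
    ring
  have hnn : ∀ i, 0 ≤ (a i - b i) ^ 2 / (a i * b i) := fun i =>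
    div_nonneg (sq_nonneg _) (mul_pos (hx0 i) (hy0 i)).le
  have hsum : ∑ i, (a i - b i) ^ 2 / (a i * b i) ≤ 0 := by
    simp only [← key, Finset.sum_sub_distrib, Finset.sum_add_distrib, Finset.sum_const,
      Finset.card_univ, Fintype.card_fin, nsmul_eq_mul]
    linarith
  have h0 := (Finset.sum_eq_zero_iff_of_nonneg fun i _ => hnn i).1
    (le_antisymm hsum (Finset.sum_nonneg fun i _ => hnn i)) i (Finset.mem_univ i)
  rw [div_eq_zero_iff, or_iff_left (mul_pos (hx0 i) (hy0 i)).ne', sq_eq_zero_iff] at h0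
  exact sub_eq_zero.1 h0

theorem IsHZSolution.utility_unique {n : ℕ} {u : Fin n → Fin n → ℝ} (hu : IsBiValued u)
    {x y : Fin n → Fin n → ℝ} (hx : IsHZSolution u x) (hy : IsHZSolution u y) (i : Fin n) :
    utility (u i) (x i) = utility (u i) (y i) := by
  have h := hx.share_unique hu hy i
  exact le_antisymm ((hu.utility_le_iff i (hx.1.row i) (hy.1.row i)).2 h.le)
    ((hu.utility_le_iff i (hy.1.row i) (hx.1.row i)).2 h.ge)

/-! ### Existence and rationality -/

/-- Bi-valued instances have rational HZ solutions with nonnegative rational prices. -/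
theorem IsBiValued.exists_rational_solution {n : ℕ} {u : Fin n → Fin n → ℝ}
    (hu : IsBiValued u) :
    ∃ (x : Fin n → Fin n → ℝ) (p : Fin n → ℝ), IsBalancedAssignment x ∧ Supports u p x ∧
      (∀ i j, IsRational (x i j)) ∧ ∀ j, 0 ≤ p j ∧ IsRational (p j) := by
  obtain ⟨x, p, m, hx0, hxr, hxc, hp, hm⟩ :=
    exists_rational_assignment (mostPreferred u) (mostPreferred_nonempty u)
  have hrow : ∀ i, IsBalancedAllocation fun j => (x i j : ℝ) := fun i =>
    isBalancedAllocation_of_nonneg (fun j => by exact_mod_cast hx0 i j) (by exact_mod_cast hxr i)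
  have hp' : ∀ j, (0 : ℝ) ≤ p j := fun j => by exact_mod_cast hp j
  refine ⟨fun i j => x i j, fun j => p j,
    ⟨⟨fun i => (hrow i).1, fun j => by dsimp only; exact_mod_cast hxc j⟩, fun i => (hrow i).2⟩, fun i => ?_,
    fun i j => ⟨_, rfl⟩, fun j => ⟨hp' j, _, rfl⟩⟩
  obtain ⟨h0, h1, h2, h3⟩ := hm i
  have h0' : (0 : ℝ) ≤ m i := by exact_mod_cast h0
  have h2' : cost (fun j => (p j : ℝ)) (fun j => (x i j : ℝ)) =
      m i * ∑ j ∈ mostPreferred u i, (x i j : ℝ) := by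
    rw [cost]
    exact_mod_cast h2
  have h3' : (∑ j ∈ mostPreferred u i, (x i j : ℝ) = 1 ∧ (m i : ℝ) ≤ 1) ∨
      m i * ∑ j ∈ mostPreferred u i, (x i j : ℝ) = 1 := by
    exact_mod_cast h3
  -- This bound is an equality at `x i`, which gives both utility maximality and cost minimality.
  have hcost : ∀ y, IsBalancedAllocation y →
      m i * ∑ j ∈ mostPreferred u i, y j ≤ cost (fun j => (p j : ℝ)) y := by
    intro y hy
    rw [Finset.mul_sum]
    refine le_trans (Finset.sum_le_sum fun j hj => mul_le_mul_of_nonneg_right ?_ (hy.1 j).1)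
      (Finset.sum_le_univ_sum_of_nonneg fun j => mul_nonneg (hp' j) (hy.1 j).1)
    exact_mod_cast h1 j hj
  refine ⟨⟨⟨hrow i, ?_⟩, isMaxOn_iff.2 fun y hy => (hu.utility_le_iff i hy.1 (hrow i)).2 ?_⟩,
    ⟨_, ⟨hrow i, le_rfl⟩, rfl⟩, ?_⟩
  · rw [h2']
    rcases h3' with h3 | h3
    · rw [h3.1, mul_one]
      exact h3.2
    · exact h3.le
  · rcases h3' with h3 | h3
    · rw [h3.1]
      exact sum_le_one_of_isBalancedAllocation hy.1 _
    · have h4 := (hcost y hy.1).trans hy.2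
      have h5 : (0 : ℝ) < m i := h0'.lt_of_ne fun h => by
        rw [← h, zero_mul] at h3
        exact zero_ne_one h3
      rw [← h3] at h4
      exact le_of_mul_le_mul_left h4 h5
  · rintro _ ⟨y, ⟨hy, hyu⟩, rfl⟩
    rw [h2']
    exact (mul_le_mul_of_nonneg_left ((hu.utility_le_iff i (hrow i) hy).1 hyu) h0').trans
      (hcost y hy)

/-- Uniqueness transfers rationality from the one rational solution to all solutions. -/
theorem IsHZSolution.isRational_share {n : ℕ} {u : Fin n → Fin n → ℝ} (hu : IsBiValued u)
    {x : Fin n → Fin n → ℝ} (hx : IsHZSolution u x) (i : Fin n) :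
    IsRational (∑ j ∈ mostPreferred u i, x i j) := by
  obtain ⟨y, p, hy, hs, hr, -⟩ := hu.exists_rational_solution
  rw [hx.share_unique hu ⟨hy, p, hs⟩ i]
  choose q hq using hr i
  exact ⟨∑ j ∈ mostPreferred u i, q j, by push_cast; simp only [hq]⟩

theorem IsHZSolution.isRational_utility {n : ℕ} {u : Fin n → Fin n → ℝ} (hu : IsBiValued u)
    {x : Fin n → Fin n → ℝ} (hx : IsHZSolution u x) (i : Fin n)
    (hr : ∀ j, IsRational (u i j)) : IsRational (utility (u i) (x i)) := by
  obtain ⟨y, p, hy, hs, hr', -⟩ := hu.exists_rational_solution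
  rw [hx.utility_unique hu ⟨hy, p, hs⟩ i]
  choose q hq using hr
  choose q' hq' using hr' i
  exact ⟨∑ j, q' j * q j, by push_cast; simp only [hq, hq', utility]⟩

/-! ### Invariance -/

theorem utility_affine {n : ℕ} (v : Fin n → ℝ) (a b : ℝ) {y : Fin n → ℝ}
    (hy : IsBalancedAllocation y) :
    utility (fun j => a * v j + b) y = a * utility v y + b := by
  have h : ∀ j, y j * (a * v j + b) = a * (y j * v j) + b * y j := fun j => by ring
  simp only [utility, h, Finset.sum_add_distrib, ← Finset.mul_sum, hy.2, mul_one]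

/-- The preference order on balanced allocations is unchanged, so the same prices support `x`. -/
theorem isHZSolution_affine_iff {n : ℕ} (u : Fin n → Fin n → ℝ) {a : Fin n → ℝ} (b : Fin n → ℝ)
    (ha : ∀ i, 0 < a i) (x : Fin n → Fin n → ℝ) :
    IsHZSolution (fun i j => a i * u i j + b i) x ↔ IsHZSolution u x := by
  have h : ∀ i y z, IsBalancedAllocation y → IsBalancedAllocation z →
      (utility (fun j => a i * u i j + b i) y ≤ utility (fun j => a i * u i j + b i) z ↔
        utility (u i) y ≤ utility (u i) z) := by
    intro i y z hy hz
    rw [utility_affine _ _ _ hy, utility_affine _ _ _ hz, add_le_add_iff_right,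
      mul_le_mul_iff_right₀ (ha i)]
  constructor <;> rintro ⟨hx, p, hp⟩ <;> refine ⟨hx, p, hp.of_order hx (fun i y z hy hz => ?_)
    (fun _ _ => Iff.rfl) fun _ _ _ _ => id⟩
  · exact h i y z hy hz
  · exact (h i y z hy hz).symm

end HZ

theorem mainTheorem4 (n : ℕ) (u : Fin n → Fin n → ℝ) (hu : HZ.IsBiValued u) :
    -- rationality: in every HZ solution each agent gets a rational amount of her most preferred
    -- items (hence a rational utility if her utility values are rational), and the instance has
    -- an HZ solution with rational entries, supported by rational nonnegative prices
    ((∀ x, HZ.IsHZSolution u x → ∀ i,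
        HZ.IsRational (∑ j ∈ HZ.mostPreferred u i, x i j) ∧
        ((∀ j, HZ.IsRational (u i j)) → HZ.IsRational (HZ.utility (u i) (x i)))) ∧
      (∃ (x : Fin n → Fin n → ℝ) (p : Fin n → ℝ), HZ.IsBalancedAssignment x ∧
        HZ.Supports u p x ∧ (∀ i j, HZ.IsRational (x i j)) ∧
        ∀ j, 0 ≤ p j ∧ HZ.IsRational (p j))) ∧
    -- each agent gets the same utility in all HZ solutions
    (∀ x y, HZ.IsHZSolution u x → HZ.IsHZSolution u y →
      ∀ i, HZ.utility (u i) (x i) = HZ.utility (u i) (y i)) ∧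
    -- the set of HZ solutions is invariant to scaling and shifting of each agent's utilities
    (∀ a b : Fin n → ℝ, (∀ i, 0 < a i) →
      {x | HZ.IsHZSolution (fun i j => a i * u i j + b i) x} = {x | HZ.IsHZSolution u x}) := by
  exact ⟨⟨fun x hx i => ⟨hx.isRational_share hu i, hx.isRational_utility hu i⟩,
      hu.exists_rational_solution⟩,
    fun x y hx hy i => hx.utility_unique hu hy i,
    fun a b ha => Set.ext fun x => HZ.isHZSolution_affine_iff u b ha x⟩
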